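/- **Conventions.** A diffeological space is a set $X$ with a specified collection of functions $U\to X$ ($U$ open in $\mathbb R^n$, $n\in\mathbb N$), called plots, that contains the constant functions, is closed under precomposition with smooth maps, and satisfies the sheaf condition for open covers. A function is smooth if it sends plots to plots. Subsets, products and quotients carry the sub-, product and quotient diffeologies. A subduction is a surjection $X\to Y$ such that the plots of $Y$ are exactly the functions that locally lift to plots of $X$. A diffeological group is a group with a diffeology for which multiplication and inversion are smooth. The internal tangent space $T_x(X)$ is the colimit, in real vector spaces, of $T_0(U)$ over the category of pointed plots $p:(U,0)\to(X,x)$, with $U$ a connected open neighbourhood of $0$ in some $\mathbb R^n$, and pointed smooth maps $f$ of the domains commuting with the plots; $p_*(u)$ is the class of $u\in T_0(U)$. A smooth map $f$ with $f(x)=y$ induces the linear map $f_*:T_x(X)\to T_y(Y)$, $f_*(p_*(u))=(f\circ p)_*(u)$. On $TX=\coprod_{x}T_x(X)$, Hector's diffeology is the one generated by the functions $Tp:TU\to TX$ for all plots $p:U\to X$ with $U$ connected, where $Tp$ is given on $T_u(U)$ by translation to $T_0(U-u)$ followed by the canonical map to $T_{p(u)}(X)$. The dvs diffeology is the smallest diffeology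 on $TX$ that contains Hector's diffeology and makes $TX$ a diffeological vector space over $X$, i.e. makes the projection $TX\to X$, the zero section, scalar multiplication $\mathbb R\times TX\to TX$ and fibrewise addition $TX\times_X TX\to TX$ smooth. $T^H_x(X)$ and $T^{dvs}_x(X)$ denote the vector space $T_x(X)$ with the sub-diffeologies of these two. **Corollary 3.3.** Let $G$ be a diffeological group, let $H$ be any subgroup of $G$, and let $e$ be the identity element; let $G/H$ be the set of left cosets with the quotient diffeology. Then the inclusion $\iota:H\to G$ and the projection $\pi:G\to G/H$ induce an exact sequence of vector spaces $$T_e(H)\xrightarrow{\ \iota_*\ }T_e(G)\xrightarrow{\ \pi_*\ }T_{eH}(G/H)\to 0 .$$ Moreover, $T^H_{eH}(G/H)=T^{dvs}_{eH}(G/H)$ as diffeological spaces, and both $\pi_*:T^H_e(G)\to T^H_{eH}(G/H)$ and $\pi_*:T^{dvs}_e(G)\to T^{dvs}_{eH}(G/H)$ are subductions. -/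

import Mathlib

/-!
Mathlib's `DiffeologicalSpace` records the plots with domain `ℝⁿ`; `IsPlotOn` recovers the plots
whose domain is an open subset of `ℝⁿ`.
-/

open scoped ContDiff

noncomputable section

namespace Diffeology

universe u v

/-- The Euclidean space `ℝⁿ`. -/
abbrev Euc (n : ℕ) : Type := EuclideanSpace ℝ (Fin n)

section Constructions

variable {X : Type u} {Y : Type v}

/-- `p` restricts to a plot `U → X` on the open set `U ⊆ ℝⁿ`: its composite with every smooth map
`ℝᵐ → U` is a plot. By the sheaf condition these are exactly the functions on `U` whose
restriction to each ball contained in `U` is a plot (balls being diffeomorphic to `ℝⁿ`).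
Values of `p` outside `U` are irrelevant. -/
def IsPlotOn [DiffeologicalSpace X] {n : ℕ} (p : Euc n → X) (U : Set (Euc n)) : Prop :=
  ∀ (m : ℕ) (f : Euc m → Euc n), (∀ t, f t ∈ U) → ContDiff ℝ ∞ f → IsPlot (p ∘ f)

/-- The function `p : ℝⁿ → Y` locally lifts along `π : X → Y` to plots of `X`. -/
def LocallyLifts [DiffeologicalSpace X] (π : X → Y) {n : ℕ} (p : Euc n → Y) : Prop :=
  ∀ t : Euc n, ∃ U : Set (Euc n), IsOpen U ∧ t ∈ U ∧
    ∃ q : Euc n → X, IsPlotOn q U ∧ Set.EqOn (π ∘ q) p U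

/-- The diffeology on `X` induced by `f : X → Y`: `p` is a plot iff `f ∘ p` is a plot of `Y`. -/
@[reducible]
def inducedDiffeology (f : X → Y) (d : DiffeologicalSpace Y) : DiffeologicalSpace X where
  plots n := {p | IsPlot (f ∘ p)}
  constant_plots x := isPlot_const (x := f x)
  plot_reparam hp hf := isPlot_reparam (X := Y) hp hf
  locality hp := DiffeologicalSpace.locality fun x => by
    obtain ⟨u, hu, hxu, h⟩ := hp x
    exact ⟨u, hu, hxu, fun h1 h2 => h h1 h2⟩

/-- Subsets carry the sub-diffeology. -/
instance [d : DiffeologicalSpace X] (P : X → Prop) : DiffeologicalSpace (Subtype P) :=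
  inducedDiffeology Subtype.val d

/-- Products carry the product diffeology: `p` is a plot iff both of its components are. -/
instance [dX : DiffeologicalSpace X] [dY : DiffeologicalSpace Y] : DiffeologicalSpace (X × Y) :=
  inducedDiffeology Prod.fst dX ⊓ inducedDiffeology Prod.snd dY

/-- Near any point, every open set contains the image of a smooth map `ℝⁿ → ℝⁿ` which is the
identity near that point. -/
theorem exists_smooth_retraction {n : ℕ} {U : Set (Euc n)} (hU : IsOpen U) {t : Euc n}
    (ht : t ∈ U) : ∃ φ : Euc n → Euc n, ContDiff ℝ ∞ φ ∧ (∀ s, φ s ∈ U) ∧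
      ∃ W : Set (Euc n), IsOpen W ∧ t ∈ W ∧ ∀ s ∈ W, φ s = s := by
  obtain ⟨ε, hε, hεU⟩ := Metric.isOpen_iff.mp hU t ht
  let χ : ContDiffBump t := ⟨ε / 2, ε, by positivity, by linarith⟩
  refine ⟨fun s => t + χ s • (s - t), ?_, fun s => hεU ?_, Metric.ball t (ε / 2),
    Metric.isOpen_ball, Metric.mem_ball_self (by positivity), fun s hs => ?_⟩
  · exact contDiff_const.add (χ.contDiff.smul (contDiff_id.sub contDiff_const))
  · by_cases hs : s ∈ Metric.ball t ε
    · rw [Metric.mem_ball, dist_eq_norm] at hs ⊢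
      have h1 : ‖χ s‖ ≤ 1 := by
        rw [Real.norm_of_nonneg χ.nonneg]
        exact χ.le_one
      rw [add_sub_cancel_left, norm_smul]
      calc ‖χ s‖ * ‖s - t‖ ≤ 1 * ‖s - t‖ := by gcongr
        _ < ε := by simpa using hs
    · have h0 : χ s = 0 := χ.zero_of_le_dist (not_lt.mp hs)
      simpa [h0] using hε
  · have h1 : χ s = 1 := χ.one_of_mem_closedBall (Metric.ball_subset_closedBall hs)
    simp [h1]

/-- The quotient diffeology: a function into the quotient is a plot iff it locally lifts along the
quotient map to plots of `X`. -/
@[reducible]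
def quotientDiffeology [DiffeologicalSpace X] (s : Setoid X) :
    DiffeologicalSpace (Quotient s) where
  plots n := {p | LocallyLifts (Quotient.mk s) p}
  constant_plots {n} y t := by
    obtain ⟨x, rfl⟩ := Quotient.exists_rep y
    exact ⟨Set.univ, isOpen_univ, Set.mem_univ t, fun _ => x,
      fun _ _ _ _ => isPlot_const, fun _ _ => rfl⟩
  plot_reparam {n m p f} hp hf t := by
    obtain ⟨U, hU, htU, q, hq, hqp⟩ := hp (f t)
    exact ⟨f ⁻¹' U, hU.preimage hf.continuous, htU, q ∘ f,
      fun k g hg hgs => hq k (f ∘ g) hg (hf.comp hgs), fun a ha => hqp ha⟩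
  locality {n p} hp t := by
    obtain ⟨u, hu, htu, h⟩ := hp t
    obtain ⟨φ, hφ, hφu, W, hW, htW, hφW⟩ := exists_smooth_retraction hu htu
    obtain ⟨U, hU, htU, q, hq, hqp⟩ := h hφu hφ t
    refine ⟨U ∩ W, hU.inter hW, ⟨htU, htW⟩, q, fun k g hg hgs => hq k g (fun a => (hg a).1) hgs,
      fun a ha => ?_⟩
    rw [hqp ha.1, Function.comp_apply, hφW a ha.2]

/-- The set `G ⧸ H` of left cosets carries the quotient diffeology. -/
instance {G : Type u} [Group G] [DiffeologicalSpace G] (H : Subgroup G) :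
    DiffeologicalSpace (G ⧸ H) :=
  quotientDiffeology (QuotientGroup.leftRel H)

/-- A subduction, i.e. a quotient map of diffeological spaces: a surjection such that the plots of
the codomain are exactly the functions that locally lift to plots of the domain. -/
def IsSubduction (dX : DiffeologicalSpace X) (dY : DiffeologicalSpace Y) (f : X → Y) : Prop :=
  Function.Surjective f ∧ ∀ (n : ℕ) (p : Euc n → Y), IsPlot p ↔ LocallyLifts f p

theorem dSmooth_val [DiffeologicalSpace X] (P : X → Prop) :
    DSmooth (Subtype.val : Subtype P → X) :=
  fun _ _ hp => hp

theorem dSmooth_coset {G : Type u} [Group G] [DiffeologicalSpace G] (H : Subgroup G) :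
    DSmooth (QuotientGroup.mk : G → G ⧸ H) :=
  fun _ p hp _ => ⟨Set.univ, isOpen_univ, Set.mem_univ _, p,
    fun _ _ _ hf => isPlot_reparam hp hf, fun _ _ => rfl⟩

end Constructions

/-- A diffeological group: a diffeological space with a group structure whose operations are
smooth. -/
class DiffeologicalGroup (G : Type u) [Group G] [DiffeologicalSpace G] : Prop where
  smooth_mul : DSmooth (fun a : G × G => a.1 * a.2)
  smooth_inv : DSmooth (fun a : G => a⁻¹)

section Tangent

/-- A plot `U → X` defined on a connected open set `U ⊆ ℝⁿ`. -/
structure LocalPlot (X : Type u) [DiffeologicalSpace X] where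
  dim : ℕ
  dom : Set (Euc dim)
  isOpen_dom : IsOpen dom
  isConnected_dom : IsConnected dom
  toFun : Euc dim → X
  isPlotOn : IsPlotOn toFun dom

/-- A pointed plot `(U, 0) → (X, x)`, with `U` a connected open neighbourhood of `0` in `ℝⁿ`: an
object of the category of plots of `X` centered at `x`. -/
structure CenteredPlot (X : Type u) [DiffeologicalSpace X] (x : X) extends LocalPlot X where
  zero_mem : (0 : Euc dim) ∈ dom
  map_zero : toFun 0 = x

variable {X : Type u} [DiffeologicalSpace X] {Y : Type v} [DiffeologicalSpace Y]

/-- `f` is a morphism `r ⟶ q` in the category of plots of `X` centered at `x`: a smooth map between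
the domains with `f 0 = 0` and `r = q ∘ f`. -/
structure IsPlotMorphism {x : X} (r q : CenteredPlot X x) (f : Euc r.dim → Euc q.dim) : Prop where
  contDiffOn : ContDiffOn ℝ ∞ f r.dom
  mapsTo : Set.MapsTo f r.dom q.dom
  map_zero : f 0 = 0
  comp_eq : Set.EqOn r.toFun (q.toFun ∘ f) r.dom

/-- The direct sum `⨁ T₀(U)` over all pointed plots `(U, 0) → (X, x)`, with `T₀(U) = ℝⁿ`. -/
abbrev TangentSum (X : Type u) [DiffeologicalSpace X] (x : X) : Type u :=
  DirectSum (CenteredPlot X x) fun r => Euc r.dim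

open Classical in
/-- The inclusion of the summand indexed by `r`. -/
def TangentSum.of {x : X} (r : CenteredPlot X x) : Euc r.dim →ₗ[ℝ] TangentSum X x :=
  DirectSum.lof ℝ (CenteredPlot X x) (fun r => Euc r.dim) r

/-- The span of the relations `(r, v) = (q, f_* v)`, for all morphisms `f : r ⟶ q`. -/
def tangentRelations (X : Type u) [DiffeologicalSpace X] (x : X) :
    Submodule ℝ (TangentSum X x) :=
  Submodule.span ℝ {w | ∃ (r q : CenteredPlot X x) (f : Euc r.dim → Euc q.dim) (v : Euc r.dim),
    IsPlotMorphism r q f ∧ w = TangentSum.of r v - TangentSum.of q (fderiv ℝ f 0 v)}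

/-- The internal tangent space `T_x(X)`: the colimit in real vector spaces of `T₀(U)` over the
category of plots `(U, 0) → (X, x)` centered at `x`, presented as the quotient of the direct sum by
the relations coming from the morphisms. -/
abbrev InternalTangentSpace (X : Type u) [DiffeologicalSpace X] (x : X) : Type u :=
  TangentSum X x ⧸ tangentRelations X x

/-- The vector `r_*(v)` in `T_x(X)` represented by a pointed plot `r` and `v ∈ T₀(U)`. -/
def CenteredPlot.push {x : X} (r : CenteredPlot X x) :
    Euc r.dim →ₗ[ℝ] InternalTangentSpace X x :=
  (tangentRelations X x).mkQ ∘ₗ TangentSum.of r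

/-- Composition of a pointed plot with a pointed smooth map. -/
def CenteredPlot.comp {x : X} (r : CenteredPlot X x) (f : X → Y) (hf : DSmooth f) {y : Y}
    (hxy : f x = y) : CenteredPlot Y y where
  dim := r.dim
  dom := r.dom
  isOpen_dom := r.isOpen_dom
  isConnected_dom := r.isConnected_dom
  toFun := f ∘ r.toFun
  isPlotOn := fun m g hg hgs => hf m _ (r.isPlotOn m g hg hgs)
  zero_mem := r.zero_mem
  map_zero := by rw [Function.comp_apply, r.map_zero, hxy]

open Classical in
/-- The linear map `⨁ T₀(U) → ⨁ T₀(U)` induced by a smooth map `f` with `f x = y`; it sends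
`(r, v)` to `(f ∘ r, v)`. -/
def tangentSumMap (f : X → Y) (hf : DSmooth f) {x : X} {y : Y} (hxy : f x = y) :
    TangentSum X x →ₗ[ℝ] TangentSum Y y :=
  DirectSum.toModule ℝ (CenteredPlot X x) (TangentSum Y y)
    fun r => (TangentSum.of (r.comp f hf hxy) : Euc r.dim →ₗ[ℝ] TangentSum Y y)

open Classical in
theorem tangentSumMap_of (f : X → Y) (hf : DSmooth f) {x : X} {y : Y} (hxy : f x = y)
    (r : CenteredPlot X x) (v : Euc r.dim) :
    tangentSumMap f hf hxy (TangentSum.of r v) = TangentSum.of (r.comp f hf hxy) v :=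
  DirectSum.toModule_lof ℝ (M := fun r : CenteredPlot X x => Euc r.dim) r v

theorem tangentRelations_le_comap (f : X → Y) (hf : DSmooth f) {x : X} {y : Y} (hxy : f x = y) :
    tangentRelations X x ≤ (tangentRelations Y y).comap (tangentSumMap f hf hxy) := by
  refine Submodule.span_le.mpr ?_
  rintro _ ⟨r, q, g, v, hg, rfl⟩
  refine Submodule.subset_span ⟨r.comp f hf hxy, q.comp f hf hxy, g, v,
    ⟨hg.contDiffOn, hg.mapsTo, hg.map_zero, fun t ht => congrArg f (hg.comp_eq ht)⟩, ?_⟩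
  rw [map_sub, tangentSumMap_of, tangentSumMap_of]
  rfl

/-- The linear map `f_* : T_x(X) → T_y(Y)` induced by a smooth map `f` with `f x = y`; it sends
`r_*(v)` to `(f ∘ r)_*(v)`. -/
def tangentMap (f : X → Y) (hf : DSmooth f) {x : X} {y : Y} (hxy : f x = y) :
    InternalTangentSpace X x →ₗ[ℝ] InternalTangentSpace Y y :=
  Submodule.mapQ (tangentRelations X x) (tangentRelations Y y) (tangentSumMap f hf hxy)
    (tangentRelations_le_comap f hf hxy)

/-- The internal tangent bundle `TX`, as a set. -/
abbrev InternalTangentBundle (X : Type u) [DiffeologicalSpace X] : Type u :=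
  Σ x : X, InternalTangentSpace X x

/-- The plot `t ↦ r (t + a)`, centered at `r a`, for a point `a` of the domain of the plot `r`. -/
def LocalPlot.centerAt (r : LocalPlot X) (a : Euc r.dim) (ha : a ∈ r.dom) :
    CenteredPlot X (r.toFun a) where
  dim := r.dim
  dom := (Homeomorph.addRight a) ⁻¹' r.dom
  isOpen_dom := r.isOpen_dom.preimage (Homeomorph.addRight a).continuous
  isConnected_dom := (Homeomorph.addRight a).isConnected_preimage.mpr r.isConnected_dom
  toFun := fun t => r.toFun (t + a)
  isPlotOn := fun m g hg hgs => r.isPlotOn m (fun t => g t + a) hg (hgs.add contDiff_const)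
  zero_mem := by simpa using ha
  map_zero := by simp

/-- The function `Tr : TU = U × ℝⁿ → TX` induced by a plot `r : U → X`: at `a ∈ U` it is the
translation `T_a(U) ≅ T₀(U - a)` followed by the canonical map to `T_{r(a)}(X)`. -/
def LocalPlot.tangent (r : LocalPlot X) (a : Euc r.dim) (ha : a ∈ r.dom) (v : Euc r.dim) :
    InternalTangentBundle X :=
  ⟨r.toFun a, (r.centerAt a ha).push v⟩

/-- Hector's diffeology on `TX`, giving `T^H X`: it is generated by the functions `Tr : TU → TX` for
all plots `r : U → X`, i.e. by the composites of these with smooth maps `(α, β) : ℝᵐ → TU`. -/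
@[reducible]
def hectorDiffeology (X : Type u) [DiffeologicalSpace X] :
    DiffeologicalSpace (InternalTangentBundle X) :=
  DiffeologicalSpace.generateFrom {P | ∃ (r : LocalPlot X) (α β : Euc P.1 → Euc r.dim)
    (hα : ∀ t, α t ∈ r.dom), ContDiff ℝ ∞ α ∧ ContDiff ℝ ∞ β ∧
      P.2 = fun t => r.tangent (α t) (hα t) (β t)}

/-- The diffeology `d` on the total space of a family `V` of vector spaces over `X` makes it a
diffeological vector space over `X`: the projection, the zero section, scalar multiplication and
fibrewise addition `V ×_X V → V` are smooth. The fibre product `V ×_X V = Σ x, V x × V x` has the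
sub-diffeology from the product of two copies of the total space. -/
structure IsDiffeologicalVectorSpaceOver (V : X → Type v) [∀ x, AddCommGroup (V x)]
    [∀ x, Module ℝ (V x)] (d : DiffeologicalSpace (Σ x, V x)) : Prop where
  smooth_proj : DSmooth (fun a : Σ x, V x => a.1)
  smooth_zero : DSmooth (fun x : X => (⟨x, 0⟩ : Σ x, V x))
  smooth_smul : DSmooth (fun a : ℝ × (Σ x, V x) => (⟨a.2.1, a.1 • a.2.2⟩ : Σ x, V x))
  smooth_add :
    letI : DiffeologicalSpace (Σ x, V x × V x) := inducedDiffeology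
      (fun a => ((⟨a.1, a.2.1⟩, ⟨a.1, a.2.2⟩) : (Σ x, V x) × (Σ x, V x))) inferInstance
    DSmooth (fun a : Σ x, V x × V x => (⟨a.1, a.2.1 + a.2.2⟩ : Σ x, V x))

/-- The dvs diffeology on `TX`, giving `T^{dvs} X`: the smallest diffeology containing Hector's
diffeology and making `TX` a diffeological vector space over `X`. -/
@[reducible]
def dvsDiffeology (X : Type u) [DiffeologicalSpace X] :
    DiffeologicalSpace (InternalTangentBundle X) :=
  sInf {d | hectorDiffeology X ≤ d ∧ IsDiffeologicalVectorSpaceOver (InternalTangentSpace X) d}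

/-- `T^H_x X`: the tangent space `T_x(X)` with the sub-diffeology of `T^H X`. -/
@[reducible]
def hectorFiberDiffeology (x : X) : DiffeologicalSpace (InternalTangentSpace X x) :=
  inducedDiffeology (Sigma.mk x) (hectorDiffeology X)

/-- `T^{dvs}_x X`: the tangent space `T_x(X)` with the sub-diffeology of `T^{dvs} X`. -/
@[reducible]
def dvsFiberDiffeology (x : X) : DiffeologicalSpace (InternalTangentSpace X x) :=
  inducedDiffeology (Sigma.mk x) (dvsDiffeology X)

end Tangent

section Coset

variable {G : Type u} [Group G] [DiffeologicalSpace G] (H : Subgroup G)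

/-- `ι_* : T_e(H) → T_e(G)`, induced by the inclusion of a subgroup. -/
def subgroupTangentMap : InternalTangentSpace H 1 →ₗ[ℝ] InternalTangentSpace G 1 :=
  tangentMap (Subtype.val : H → G) (dSmooth_val _) H.coe_one

/-- `π_* : T_e(G) → T_{eH}(G/H)`, induced by the projection to the left cosets. -/
def cosetTangentMap :
    InternalTangentSpace G 1 →ₗ[ℝ] InternalTangentSpace (G ⧸ H) (QuotientGroup.mk (1 : G)) :=
  tangentMap (QuotientGroup.mk : G → G ⧸ H) (dSmooth_coset H) rfl

end Coset

end Diffeology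

end

open Diffeology

open scoped Topology

noncomputable section

namespace Diffeology

universe u v

/-! ### Germs of plots and the sheaf condition -/

section Local

variable {X : Type u} {Y : Type v}

/-! Two facts drive the proof. In a group, the plot `(s, t) ↦ p s * q t` turns the sum of the
derivatives of `p` and `q` at the identity into the derivative of a single plot
(`plotDeriv_extMul`). In `G ⧸ H`, plots lift locally to `G`, and two lifts of one germ differ by
right multiplication by a plot of `H`.

Exactness: by the product rule, the derivatives of two lifts centred at `1` differ by a vector in
the range of `ι_*` (`plotDeriv_sub_mem_range`). Differentiating lifts therefore defines a linear map
from the tangent space of `G ⧸ H` to `T_e(G)` modulo that range, and its composite with `π_*` is the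
quotient map. So the kernel of `π_*` lies in the range of `ι_*`. Surjectivity holds because lifts
exist.

Subduction for Hector's diffeology: a plot of the fibre is locally constant or of the form `Tp (α t,
β t)` with `p (α t)` the base point. A lift `q` of `p` only satisfies `q (α t) ∈ H`. The plot `(s,
t) ↦ q s * (q (α t))⁻¹` corrects this and still projects to `p s`.

Equality of the two diffeologies: it suffices that addition and scalar multiplication are smooth on
the Hector fibre (`hectorFiberDiffeology_eq_dvsFiberDiffeology`). This holds at `1` in `G` by the
product construction and descends along `π_*`. The dvs subduction is then the Hector one. -/

theorem exists_smooth_retraction_of_mem_nhds {n : ℕ} {t : Euc n} {U : Set (Euc n)} (hU : U ∈ 𝓝 t) :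
    ∃ φ : Euc n → Euc n, ContDiff ℝ ∞ φ ∧ (∀ s, φ s ∈ U) ∧ φ =ᶠ[𝓝 t] id := by
  obtain ⟨V, hVU, hV, htV⟩ := mem_nhds_iff.mp hU
  obtain ⟨φ, hφ, hφV, W, hW, htW, h⟩ := exists_smooth_retraction hV htV
  exact ⟨φ, hφ, fun s => hVU (hφV s), Filter.eventuallyEq_of_mem (hW.mem_nhds htW) h⟩

/-- Precomposition with a retraction keeps the germ, so later arguments can use plots defined on all
of `ℝⁿ`. -/
theorem IsPlotOn.exists_isPlot [DiffeologicalSpace X] {n : ℕ} {p : Euc n → X} {U : Set (Euc n)}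
    (hp : IsPlotOn p U) {t : Euc n} (hU : U ∈ 𝓝 t) :
    ∃ q : Euc n → X, IsPlot q ∧ q =ᶠ[𝓝 t] p := by
  obtain ⟨φ, hφ, hφU, h⟩ := exists_smooth_retraction_of_mem_nhds hU
  exact ⟨p ∘ φ, hp n φ hφU hφ, h.fun_comp p⟩

theorem isPlot_of_eventuallyEq [DiffeologicalSpace X] {n : ℕ} {p : Euc n → X}
    (h : ∀ t, ∃ q : Euc n → X, IsPlot q ∧ p =ᶠ[𝓝 t] q) : IsPlot p := by
  refine DiffeologicalSpace.locality fun t => ?_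
  obtain ⟨q, hq, hpq⟩ := h t
  obtain ⟨V, hV, hVo, htV⟩ := eventually_nhds_iff.mp hpq
  refine ⟨V, hVo, htV, fun {m f} hf hfs => ?_⟩
  have : p ∘ f = q ∘ f := funext fun s => hV _ (hf s)
  rw [this]
  exact isPlot_reparam hq hfs

theorem locallyLifts_iff [DiffeologicalSpace X] {π : X → Y} {n : ℕ} {p : Euc n → Y} :
    LocallyLifts π p ↔ ∀ t, ∃ q : Euc n → X, IsPlot q ∧ π ∘ q =ᶠ[𝓝 t] p := by
  refine forall_congr' fun t => ⟨?_, ?_⟩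
  · rintro ⟨U, hU, htU, q, hq, h⟩
    obtain ⟨q', hq', hqq⟩ := hq.exists_isPlot (hU.mem_nhds htU)
    exact ⟨q', hq', (hqq.fun_comp π).trans (Filter.eventuallyEq_of_mem (hU.mem_nhds htU) h)⟩
  · rintro ⟨q, hq, h⟩
    obtain ⟨V, hV, hVo, htV⟩ := eventually_nhds_iff.mp h
    exact ⟨V, hVo, htV, q, fun m f _ hf => isPlot_reparam hq hf, hV⟩

/-- For a family of plots closed under reparametrization, the plots of the generated diffeology
are locally constant or members of the family. -/
theorem eventuallyEq_of_isPlot_generateFrom {g : Set ((n : ℕ) × (Euc n → X))}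
    (hg : ∀ (n : ℕ) (p : Euc n → X) (m : ℕ) (f : Euc m → Euc n), ContDiff ℝ ∞ f →
      (⟨n, p⟩ : (n : ℕ) × (Euc n → X)) ∈ g → (⟨m, p ∘ f⟩ : (n : ℕ) × (Euc n → X)) ∈ g)
    {n : ℕ} {p : Euc n → X} (hp : @IsPlot _ (DiffeologicalSpace.generateFrom g) n p) (t : Euc n) :
    (∃ w, p =ᶠ[𝓝 t] fun _ => w) ∨
      ∃ q, (⟨n, q⟩ : (n : ℕ) × (Euc n → X)) ∈ g ∧ p =ᶠ[𝓝 t] q := by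
  -- Constants are listed separately because the family need not contain them, while every
  -- diffeology does.
  let d : DiffeologicalSpace X :=
    { plots := fun n => {p | ∀ t, (∃ w, p =ᶠ[𝓝 t] fun _ => w) ∨
        ∃ q, (⟨n, q⟩ : (n : ℕ) × (Euc n → X)) ∈ g ∧ p =ᶠ[𝓝 t] q}
      constant_plots := fun x t => Or.inl ⟨x, Filter.EventuallyEq.rfl⟩
      plot_reparam := fun {n m p f} hp hf t => by
        have hft := hf.continuous.continuousAt (x := t)
        rcases hp (f t) with ⟨w, hw⟩ | ⟨q, hq, hpq⟩
        · exact Or.inl ⟨w, hft.eventually hw⟩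
        · exact Or.inr ⟨q ∘ f, hg _ _ _ _ hf hq, hft.eventually hpq⟩
      locality := fun {n p} h t => by
        obtain ⟨u, hu, htu, h⟩ := h t
        obtain ⟨φ, hφ, hφu, hid⟩ := exists_smooth_retraction_of_mem_nhds (hu.mem_nhds htu)
        have hp : p =ᶠ[𝓝 t] p ∘ φ := (hid.fun_comp p).symm
        rcases h hφu hφ t with ⟨w, hw⟩ | ⟨q, hq, hpq⟩
        · exact Or.inl ⟨w, hp.trans hw⟩
        · exact Or.inr ⟨q, hq, hp.trans hpq⟩ }
  have hle : DiffeologicalSpace.generateFrom g ≤ d :=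
    DiffeologicalSpace.generateFrom_le_iff.mpr fun n p hp t =>
      Or.inr ⟨p, hp, Filter.EventuallyEq.rfl⟩
  exact DiffeologicalSpace.le_iff'.mp hle n p hp t

end Local

/-! ### Tangent vectors, derivatives of plots, and the two fibre diffeologies -/

section Tangent

variable {X : Type u} [DiffeologicalSpace X] {Y : Type v} [DiffeologicalSpace Y]

theorem CenteredPlot.push_eq_of_isPlotMorphism {x : X} {r q : CenteredPlot X x}
    {f : Euc r.dim → Euc q.dim} (hf : IsPlotMorphism r q f) (v : Euc r.dim) :
    r.push v = q.push (fderiv ℝ f 0 v) :=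
  (Submodule.Quotient.eq _).mpr (Submodule.subset_span ⟨r, q, f, v, hf, rfl⟩)

/-- Restricting `r` to a small ball gives a plot `s` with morphisms to `r` (the identity) and to `q`
(the map `f`). Comparing through `s` shows that only germs at `0` matter in the colimit. -/
theorem CenteredPlot.push_eq_of_eventuallyEq {x : X} {r q : CenteredPlot X x}
    {f : Euc r.dim → Euc q.dim} {f' : Euc r.dim →L[ℝ] Euc q.dim} (hf : ContDiff ℝ ∞ f)
    (hf' : HasFDerivAt f f' 0) (h0 : f 0 = 0) (h : r.toFun =ᶠ[𝓝 0] q.toFun ∘ f)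
    (v : Euc r.dim) : r.push v = q.push (f' v) := by
  have hq : ∀ᶠ t in 𝓝 0, f t ∈ q.dom :=
    hf.continuous.continuousAt.eventually (by rw [h0]; exact q.isOpen_dom.mem_nhds q.zero_mem)
  obtain ⟨ε, hε, hB⟩ := Metric.eventually_nhds_iff_ball.mp
    ((h.and hq).and (r.isOpen_dom.mem_nhds r.zero_mem))
  let s : CenteredPlot X x :=
    { dim := r.dim
      dom := Metric.ball 0 ε
      isOpen_dom := Metric.isOpen_ball
      isConnected_dom := Metric.isConnected_ball hε
      toFun := r.toFun
      isPlotOn := fun m g hg hgs => r.isPlotOn m g (fun t => (hB _ (hg t)).2) hgs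
      zero_mem := Metric.mem_ball_self hε
      map_zero := r.map_zero }
  have h1 : IsPlotMorphism s r id :=
    ⟨contDiffOn_id, fun t ht => (hB t ht).2, rfl, fun t _ => rfl⟩
  have h2 : IsPlotMorphism s q f :=
    ⟨hf.contDiffOn, fun t ht => (hB t ht).1.2, h0, fun t ht => (hB t ht).1.1⟩
  have e1 := CenteredPlot.push_eq_of_isPlotMorphism h1 v
  have e2 := CenteredPlot.push_eq_of_isPlotMorphism h2 v
  rw [fderiv_id] at e1
  rw [hf'.fderiv] at e2
  exact e1.symm.trans e2

/-- A plot `ℝⁿ → X` as a plot with connected domain. -/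
def LocalPlot.ofIsPlot {n : ℕ} (p : Euc n → X) (hp : IsPlot p) : LocalPlot X where
  dim := n
  dom := Set.univ
  isOpen_dom := isOpen_univ
  isConnected_dom := isConnected_univ
  toFun := p
  isPlotOn := fun _ _ _ hf => isPlot_reparam hp hf

/-- The plot `t ↦ p (t + a)` centered at `p a`, for a plot `p : ℝⁿ → X`. -/
def CenteredPlot.ofIsPlot {n : ℕ} (p : Euc n → X) (hp : IsPlot p) (a : Euc n) {x : X}
    (h : p a = x) : CenteredPlot X x where
  toLocalPlot := LocalPlot.ofIsPlot (fun t => p (t + a))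
    (isPlot_reparam hp (contDiff_id.add contDiff_const))
  zero_mem := Set.mem_univ _
  map_zero := (congrArg p (zero_add a)).trans h

/-- The derivative at `a` of a plot `p : ℝⁿ → X`, with values in the tangent space at
`x = p a`. -/
def plotDeriv {n : ℕ} (p : Euc n → X) (hp : IsPlot p) (a : Euc n) {x : X} (h : p a = x) :
    Euc n →ₗ[ℝ] InternalTangentSpace X x :=
  (CenteredPlot.ofIsPlot p hp a h).push

/-- The chain rule for plots. -/
theorem plotDeriv_chain {n m : ℕ} {p : Euc n → X} {hp : IsPlot p} {q : Euc m → X}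
    {hq : IsPlot q} {x : X} {a : Euc n} {b : Euc m} {ha : p a = x} {hb : q b = x}
    {g : Euc n → Euc m} {g' : Euc n →L[ℝ] Euc m} (hg : ContDiff ℝ ∞ g)
    (hg' : HasFDerivAt g g' a) (hgab : g a = b) (h : p =ᶠ[𝓝 a] q ∘ g) (v : Euc n) :
    plotDeriv p hp a ha v = plotDeriv q hq b hb (g' v) := by
  have hta : Filter.Tendsto (fun t : Euc n => t + a) (𝓝 0) (𝓝 a) := by
    have : Continuous fun t : Euc n => t + a := by fun_prop
    simpa using this.tendsto 0
  let G : Euc n → Euc m := fun t => g (t + a) - b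
  refine CenteredPlot.push_eq_of_eventuallyEq (r := CenteredPlot.ofIsPlot p hp a ha)
    (q := CenteredPlot.ofIsPlot q hq b hb) (f := G) (f' := g') ?_ ?_ ?_ ?_ v
  · exact (hg.comp (contDiff_id.add contDiff_const)).sub contDiff_const
  · have : HasFDerivAt g g' (0 + a) := by rwa [zero_add]
    exact ((hasFDerivAt_comp_add_right a).mpr this).sub_const b
  · change g (0 + a) - b = 0
    rw [zero_add, hgab, sub_self]
  · filter_upwards [hta.eventually h] with t ht
    change Euc n at t
    change p (t + a) = q (g (t + a) - b + b)
    rw [ht, sub_add_cancel, Function.comp_apply]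

theorem plotDeriv_congr {n : ℕ} {p q : Euc n → X} {hp : IsPlot p} {hq : IsPlot q} {x : X}
    {a : Euc n} {ha : p a = x} {hb : q a = x} (h : p =ᶠ[𝓝 a] q) :
    plotDeriv p hp a ha = plotDeriv q hq a hb :=
  LinearMap.ext fun v => plotDeriv_chain contDiff_id (hasFDerivAt_id a) rfl h v

theorem plotDeriv_eq_zero {n : ℕ} {p : Euc n → X} {hp : IsPlot p} {x : X} {a : Euc n}
    {ha : p a = x} (h : p =ᶠ[𝓝 a] fun _ => x) : plotDeriv p hp a ha = 0 :=
  LinearMap.ext fun v => (plotDeriv_chain (q := fun _ => x) (hq := isPlot_const) (hb := rfl)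
    (g := fun _ => a) contDiff_const (hasFDerivAt_const a a) rfl h v).trans (map_zero _)

/-- A plot of `X` with domain containing a neighbourhood of `a` has the same derivative at `a` as
any plot `ℝⁿ → X` with the same germ. -/
theorem LocalPlot.tangent_eq_plotDeriv (r : LocalPlot X) {a : Euc r.dim} (ha : a ∈ r.dom)
    {q : Euc r.dim → X} (hq : IsPlot q) (h : r.toFun =ᶠ[𝓝 a] q) {x : X} (hx : r.toFun a = x)
    (hqx : q a = x) (v : Euc r.dim) :
    r.tangent a ha v = ⟨x, plotDeriv q hq a hqx v⟩ := by
  subst hx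
  have hta : Filter.Tendsto (fun t : Euc r.dim => t + a) (𝓝 0) (𝓝 a) := by
    have : Continuous fun t : Euc r.dim => t + a := by fun_prop
    simpa using this.tendsto 0
  refine congrArg (Sigma.mk (r.toFun a)) ?_
  exact CenteredPlot.push_eq_of_eventuallyEq (r := r.centerAt a ha)
    (q := CenteredPlot.ofIsPlot q hq a hqx) (f := id) contDiff_id (hasFDerivAt_id 0) rfl
    (hta.eventually h) v

theorem CenteredPlot.push_eq_plotDeriv {x : X} (r : CenteredPlot X x) {q : Euc r.dim → X}
    (hq : IsPlot q) (hqx : q 0 = x) (h : r.toFun =ᶠ[𝓝 0] q) :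
    r.push = plotDeriv q hq 0 hqx := by
  refine LinearMap.ext fun v => CenteredPlot.push_eq_of_eventuallyEq (r := r)
    (q := CenteredPlot.ofIsPlot q hq 0 hqx) (f := id) contDiff_id (hasFDerivAt_id 0) rfl ?_ v
  filter_upwards [h] with t ht
  simpa [CenteredPlot.ofIsPlot, LocalPlot.ofIsPlot] using ht

theorem CenteredPlot.exists_push_eq_plotDeriv {x : X} (r : CenteredPlot X x) :
    ∃ (q : Euc r.dim → X) (hq : IsPlot q) (hqx : q 0 = x), r.toFun =ᶠ[𝓝 0] q ∧
      r.push = plotDeriv q hq 0 hqx := by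
  obtain ⟨q, hq, h⟩ := r.isPlotOn.exists_isPlot (r.isOpen_dom.mem_nhds r.zero_mem)
  have hqx : q 0 = x := h.eq_of_nhds.trans r.map_zero
  exact ⟨q, hq, hqx, h.symm, r.push_eq_plotDeriv hq hqx h.symm⟩

theorem tangentMap_push (f : X → Y) (hf : DSmooth f) {x : X} {y : Y} (hxy : f x = y)
    (r : CenteredPlot X x) (v : Euc r.dim) :
    tangentMap f hf hxy (r.push v) = (r.comp f hf hxy).push v :=
  (Submodule.mapQ_apply _ _ _ _).trans (congrArg _ (tangentSumMap_of f hf hxy r v))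

theorem tangentMap_plotDeriv (f : X → Y) (hf : DSmooth f) {x : X} {y : Y} (hxy : f x = y) {n : ℕ}
    (p : Euc n → X) (hp : IsPlot p) (a : Euc n) (ha : p a = x) (v : Euc n) :
    tangentMap f hf hxy (plotDeriv p hp a ha v) =
      plotDeriv (f ∘ p) (hf n p hp) a (by rw [Function.comp_apply, ha, hxy]) v :=
  tangentMap_push f hf hxy (CenteredPlot.ofIsPlot p hp a ha) v

/-- Tangent spaces are spanned by the vectors represented by plots. -/
theorem InternalTangentSpace.induction {x : X} {C : InternalTangentSpace X x → Prop}
    (push : ∀ (r : CenteredPlot X x) (v : Euc r.dim), C (r.push v)) (zero : C 0)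
    (add : ∀ v w, C v → C w → C (v + w)) (v : InternalTangentSpace X x) : C v := by
  classical
  obtain ⟨z, rfl⟩ := (tangentRelations X x).mkQ_surjective v
  have h0 : C ((tangentRelations X x).mkQ 0) := by rwa [map_zero]
  have h1 : ∀ (r : CenteredPlot X x) (v : Euc r.dim),
      C ((tangentRelations X x).mkQ (DirectSum.of (fun r : CenteredPlot X x => Euc r.dim) r v)) :=
    fun r v => push r v
  have h2 : ∀ v w, C ((tangentRelations X x).mkQ v) → C ((tangentRelations X x).mkQ w) →
      C ((tangentRelations X x).mkQ (v + w)) := fun v w hv hw => by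
    rw [map_add]
    exact add _ _ hv hw
  exact DirectSum.induction_on (motive := fun z => C ((tangentRelations X x).mkQ z)) z h0 h1 h2

/-- The plots of `T^H_x X` are locally constant or of the form `t ↦ Tr (α t, β t)`. -/
theorem eventuallyEq_of_isPlot_hectorFiber {x : X} {m : ℕ} {P : Euc m → InternalTangentSpace X x}
    (hP : @IsPlot _ (hectorFiberDiffeology x) m P) (t₀ : Euc m) :
    (∃ w, P =ᶠ[𝓝 t₀] fun _ => w) ∨
      ∃ (n : ℕ) (p : Euc n → X) (hp : IsPlot p) (α β : Euc m → Euc n) (hx : ∀ t, p (α t) = x),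
        ContDiff ℝ ∞ α ∧ ContDiff ℝ ∞ β ∧
          P =ᶠ[𝓝 t₀] fun t => plotDeriv p hp (α t) (hx t) (β t) := by
  have hP' : @IsPlot _ (hectorDiffeology X) m (Sigma.mk x ∘ P) := hP
  rcases eventuallyEq_of_isPlot_generateFrom (fun n p k f hf hp => by
    obtain ⟨r, α, β, hα, hαs, hβs, h⟩ := hp
    exact ⟨r, α ∘ f, β ∘ f, fun t => hα _, hαs.comp hf, hβs.comp hf,
      funext fun t => congrFun h (f t)⟩) hP' t₀ with
    ⟨w, hw⟩ | ⟨Q, hmem, hPQ⟩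
  · refine Or.inl ⟨P t₀, ?_⟩
    filter_upwards [hw] with t ht
    exact sigma_mk_injective (ht.trans hw.eq_of_nhds.symm)
  · right
    obtain ⟨r, α, β, hα, hαs, hβs, hQ⟩ : ∃ (r : LocalPlot X) (α β : Euc m → Euc r.dim)
        (hα : ∀ t, α t ∈ r.dom), ContDiff ℝ ∞ α ∧ ContDiff ℝ ∞ β ∧
          Q = fun t => r.tangent (α t) (hα t) (β t) := hmem
    subst hQ
    obtain ⟨q, hq, hrq⟩ := r.isPlotOn.exists_isPlot (r.isOpen_dom.mem_nhds (hα t₀))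
    have hαt := hαs.continuous.continuousAt (x := t₀)
    have hev : ∀ᶠ t in 𝓝 t₀, (⟨x, P t⟩ : InternalTangentBundle X) = r.tangent (α t) (hα t) (β t) ∧
        r.toFun =ᶠ[𝓝 (α t)] q :=
      hPQ.and (hαt.eventually hrq.symm.eventuallyEq_nhds)
    -- Reparametrizing by `φ` makes the conditions valid near `t₀` hold for every `t`, as the global
    -- condition `p (α t) = x` requires.
    obtain ⟨φ, hφ, hφU, hid⟩ := exists_smooth_retraction_of_mem_nhds hev
    have hPφ : ∀ t, (⟨x, P (φ t)⟩ : InternalTangentBundle X) =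
        r.tangent (α (φ t)) (hα (φ t)) (β (φ t)) := fun t => (hφU t).1
    have hqφ : ∀ t, r.toFun =ᶠ[𝓝 (α (φ t))] q := fun t => (hφU t).2
    have hx : ∀ t, r.toFun (α (φ t)) = x := fun t => (congrArg Sigma.fst (hPφ t)).symm
    have hqx : ∀ t, q (α (φ t)) = x := fun t => (hqφ t).eq_of_nhds.symm.trans (hx t)
    refine ⟨r.dim, q, hq, α ∘ φ, β ∘ φ, hqx, hαs.comp hφ, hβs.comp hφ, ?_⟩
    filter_upwards [hid] with t ht
    have h1 := (hPφ t).trans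
      (r.tangent_eq_plotDeriv (hα (φ t)) hq (hqφ t) (hx t) (hqx t) (β (φ t)))
    exact (congrArg P ht.symm).trans (sigma_mk_injective h1)

theorem isPlot_hectorFiber_plotDeriv {x : X} {m n : ℕ} {p : Euc n → X} (hp : IsPlot p)
    {α β : Euc m → Euc n} (hα : ContDiff ℝ ∞ α) (hβ : ContDiff ℝ ∞ β) (hx : ∀ t, p (α t) = x) :
    @IsPlot _ (hectorFiberDiffeology x) m fun t => plotDeriv p hp (α t) (hx t) (β t) := by
  refine DiffeologicalSpace.isPlot_generatedFrom_of_mem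
    ⟨LocalPlot.ofIsPlot p hp, α, β, fun _ => Set.mem_univ _, hα, hβ, funext fun t => ?_⟩
  exact ((LocalPlot.ofIsPlot p hp).tangent_eq_plotDeriv (a := α t) (Set.mem_univ _) hp
    Filter.EventuallyEq.rfl (hx t) (hx t) (β t)).symm

/-- The scalar is absorbed into `β`. For a locally constant plot there is no `β` to rescale, so `hw`
is used to write the constant vector as the derivative of one plot. -/
theorem isPlot_hectorFiber_smul {x : X} {m : ℕ} {c : Euc m → ℝ}
    {P : Euc m → InternalTangentSpace X x} (hc : ContDiff ℝ ∞ c)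
    (hP : @IsPlot _ (hectorFiberDiffeology x) m P)
    (hw : ∀ w : InternalTangentSpace X x, ∃ (n : ℕ) (p : Euc n → X) (hp : IsPlot p) (a : Euc n)
      (ha : p a = x) (v : Euc n), w = plotDeriv p hp a ha v) :
    @IsPlot _ (hectorFiberDiffeology x) m fun t => c t • P t := by
  let _ := hectorFiberDiffeology x
  refine isPlot_of_eventuallyEq fun t => ?_
  rcases eventuallyEq_of_isPlot_hectorFiber hP t with
    ⟨w, h⟩ | ⟨n, p, hp, α, β, hx, hα, hβ, h⟩
  · obtain ⟨n, p, hp, a, ha, v, rfl⟩ := hw w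
    refine ⟨_, isPlot_hectorFiber_plotDeriv hp (α := fun _ => a) (β := fun t => c t • v)
      contDiff_const (hc.smul contDiff_const) (fun _ => ha), ?_⟩
    filter_upwards [h] with s hs
    rw [hs, map_smul]
  · refine ⟨_, isPlot_hectorFiber_plotDeriv hp (β := fun t => c t • β t) hα (hc.smul hβ) hx, ?_⟩
    filter_upwards [h] with s hs
    rw [hs, map_smul]

theorem isPlot_proj_hector {m : ℕ} {P : Euc m → InternalTangentBundle X}
    (hP : @IsPlot _ (hectorDiffeology X) m P) : IsPlot fun t => (P t).1 := by
  have : hectorDiffeology X ≤ inducedDiffeology Sigma.fst inferInstance :=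
    DiffeologicalSpace.generateFrom_le_iff.mpr <| by
      intro n p hp
      obtain ⟨r, α, β, hα, hαs, hβs, h⟩ : ∃ (r : LocalPlot X) (α β : Euc n → Euc r.dim)
        (hα : ∀ t, α t ∈ r.dom), ContDiff ℝ ∞ α ∧ ContDiff ℝ ∞ β ∧
          p = fun t => r.tangent (α t) (hα t) (β t) := hp
      subst h
      exact r.isPlotOn n α hα hαs
  exact DiffeologicalSpace.le_iff'.mp this m P hP

theorem hectorDiffeology_le_dvsDiffeology : hectorDiffeology X ≤ dvsDiffeology X :=
  le_sInf fun _ hd => hd.1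

/-- If the vector space operations of `T^H_x X` are smooth, then `T^H_x X = T^{dvs}_x X`. -/
theorem hectorFiberDiffeology_eq_dvsFiberDiffeology (x : X)
    (hadd : ∀ (m : ℕ) (P Q : Euc m → InternalTangentSpace X x),
      @IsPlot _ (hectorFiberDiffeology x) m P → @IsPlot _ (hectorFiberDiffeology x) m Q →
        @IsPlot _ (hectorFiberDiffeology x) m fun t => P t + Q t)
    (hsmul : ∀ (m : ℕ) (c : Euc m → ℝ) (P : Euc m → InternalTangentSpace X x),
      ContDiff ℝ ∞ c → @IsPlot _ (hectorFiberDiffeology x) m P →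
        @IsPlot _ (hectorFiberDiffeology x) m fun t => c t • P t) :
    hectorFiberDiffeology x = dvsFiberDiffeology x := by
  -- the functions over plots of `X` whose restrictions to the fibre over `x` are plots of `T^H_x X`
  let d : DiffeologicalSpace (InternalTangentBundle X) :=
    { plots := fun m => {P | IsPlot (fun t => (P t).1) ∧
        ∀ (k : ℕ) (f : Euc k → Euc m) (Q : Euc k → InternalTangentSpace X x), ContDiff ℝ ∞ f →
          (∀ t, P (f t) = ⟨x, Q t⟩) → @IsPlot _ (hectorFiberDiffeology x) k Q}
      constant_plots := fun {n} w => ⟨isPlot_const, fun k f Q _ hQ => by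
        have hQ0 : Q = fun _ => Q 0 :=
          funext fun t => sigma_mk_injective ((hQ t).symm.trans (hQ 0))
        rw [hQ0]
        exact @isPlot_const _ (hectorFiberDiffeology x) k (Q 0)⟩
      plot_reparam := fun {n m p f} hp hf => ⟨isPlot_reparam hp.1 hf, fun k g Q hg hQ =>
        hp.2 k (f ∘ g) Q (hf.comp hg) hQ⟩
      locality := fun {n p} h => by
        refine ⟨DiffeologicalSpace.locality fun t => ?_, fun k f Q hf hQ => ?_⟩
        · obtain ⟨u, hu, htu, h⟩ := h t
          exact ⟨u, hu, htu, fun hf hfs => (h hf hfs).1⟩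
        · refine (hectorFiberDiffeology x).locality fun t => ?_
          obtain ⟨u, hu, htu, h⟩ := h (f t)
          exact ⟨f ⁻¹' u, hu.preimage hf.continuous, htu, fun {l g} hg hgs =>
            (h hg (hf.comp hgs)).2 l id (Q ∘ g) contDiff_id fun s => hQ (g s)⟩ }
  -- `d` competes in the infimum defining the dvs diffeology. Its fibre condition is tested only
  -- over `x`, where `hadd` and `hsmul` apply.
  have hd : dvsDiffeology X ≤ d := by
    refine sInf_le ⟨DiffeologicalSpace.le_iff'.mpr fun m P hP =>
      ⟨isPlot_proj_hector hP, fun k f Q hf hQ => ?_⟩, ?_, ?_, ?_, ?_⟩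
    · have : Sigma.mk x ∘ Q = P ∘ f := funext fun t => (hQ t).symm
      change @IsPlot _ (hectorDiffeology X) k (Sigma.mk x ∘ Q)
      rw [this]
      exact @isPlot_reparam _ (hectorDiffeology X) _ _ _ _ hP hf
    · exact fun m P hP => hP.1
    · refine fun m p hp => ⟨hp, fun k f Q hf hQ => ?_⟩
      have : Q = fun _ => 0 := funext fun t => by
        have h := hQ t
        simp only [Function.comp_apply] at h
        have hx : p (f t) = x := congrArg Sigma.fst h
        rw [hx] at h
        exact (sigma_mk_injective h).symm
      rw [this]
      exact @isPlot_const _ (hectorFiberDiffeology x) k 0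
    · refine fun m P hP => ⟨hP.2.1, fun k f Q hf hQ => ?_⟩
      have hx : ∀ t, (P (f t)).2.1 = x := fun t => congrArg Sigma.fst (hQ t)
      -- The base point equals `x` only propositionally; naming the vector in the fixed fibre avoids
      -- transport.
      have hR : ∀ t, ∃ w : InternalTangentSpace X x, (P (f t)).2 = ⟨x, w⟩ := fun t => by
        have h := hx t
        generalize (P (f t)).2 = z at h
        obtain ⟨y, w⟩ := z
        subst h
        exact ⟨w, rfl⟩
      choose R hR using hR
      have hRP := hP.2.2 k f R hf hR
      have hc : ContDiff ℝ ∞ fun t => (P (f t)).1 :=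
        (isPlot_iff_contDiff.mp (show IsPlot fun t => (P t).1 from hP.1)).comp hf
      have : Q = fun t => (P (f t)).1 • R t := funext fun t => by
        have h := hQ t
        simp only [Function.comp_apply] at h
        rw [hR t] at h
        exact (sigma_mk_injective h).symm
      rw [this]
      exact hsmul k _ R hc hRP
    · refine fun m P hP => ⟨hP.1.1, fun k f Q hf hQ => ?_⟩
      have hx : ∀ t, (P (f t)).1 = x := fun t => congrArg Sigma.fst (hQ t)
      have hR : ∀ t, ∃ w : InternalTangentSpace X x × InternalTangentSpace X x,
          P (f t) = ⟨x, w⟩ := fun t => by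
        have h := hx t
        generalize P (f t) = z at h
        obtain ⟨y, w⟩ := z
        subst h
        exact ⟨w, rfl⟩
      choose R hR using hR
      have h1 := hP.1.2 k f (fun t => (R t).1) hf fun t =>
        congrArg (fun z : Σ x, InternalTangentSpace X x × InternalTangentSpace X x =>
          (⟨z.1, z.2.1⟩ : InternalTangentBundle X)) (hR t)
      have h2 := hP.2.2 k f (fun t => (R t).2) hf fun t =>
        congrArg (fun z : Σ x, InternalTangentSpace X x × InternalTangentSpace X x =>
          (⟨z.1, z.2.2⟩ : InternalTangentBundle X)) (hR t)
      have : Q = fun t => (R t).1 + (R t).2 := funext fun t => by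
        have h := hQ t
        simp only [Function.comp_apply] at h
        rw [hR t] at h
        exact (sigma_mk_injective h).symm
      rw [this]
      exact hadd k _ _ h1 h2
  refine DiffeologicalSpace.ext (funext fun m => funext fun P => propext
    ⟨fun hP => ?_, fun hP => ?_⟩)
  · exact DiffeologicalSpace.le_iff'.mp hectorDiffeology_le_dvsDiffeology m _ hP
  · exact (DiffeologicalSpace.le_iff'.mp hd m _ hP).2 m id P contDiff_id fun _ => rfl

end Tangent

/-! ### Plots of a fibre and their images under tangent maps -/

section Fiber

variable {X : Type u} [DiffeologicalSpace X] {Y : Type v} [DiffeologicalSpace Y]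

/-- If every tangent vector at `x` is the derivative of a single plot, then the plots of `T^H_x X`
are locally of the form `t ↦ Tr (α t, β t)`. -/
theorem exists_plotDeriv_of_isPlot_hectorFiber {x : X}
    (hw : ∀ w : InternalTangentSpace X x, ∃ (n : ℕ) (p : Euc n → X) (hp : IsPlot p) (a : Euc n)
      (ha : p a = x) (v : Euc n), w = plotDeriv p hp a ha v)
    {m : ℕ} {P : Euc m → InternalTangentSpace X x}
    (hP : @IsPlot _ (hectorFiberDiffeology x) m P) (t₀ : Euc m) :
    ∃ (n : ℕ) (p : Euc n → X) (hp : IsPlot p) (α β : Euc m → Euc n) (hx : ∀ t, p (α t) = x),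
      ContDiff ℝ ∞ α ∧ ContDiff ℝ ∞ β ∧
        P =ᶠ[𝓝 t₀] fun t => plotDeriv p hp (α t) (hx t) (β t) := by
  rcases eventuallyEq_of_isPlot_hectorFiber hP t₀ with ⟨w, h⟩ | h
  · obtain ⟨n, p, hp, a, ha, v, rfl⟩ := hw w
    exact ⟨n, p, hp, fun _ => a, fun _ => v, fun _ => ha, contDiff_const, contDiff_const, h⟩
  · exact h

theorem isPlot_hectorFiber_tangentMap (f : X → Y) (hf : DSmooth f) {x : X} {y : Y} (hxy : f x = y)
    {m : ℕ} {P : Euc m → InternalTangentSpace X x}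
    (hP : @IsPlot _ (hectorFiberDiffeology x) m P) :
    @IsPlot _ (hectorFiberDiffeology y) m fun t => tangentMap f hf hxy (P t) := by
  let _ := hectorFiberDiffeology y
  refine isPlot_of_eventuallyEq fun t => ?_
  rcases eventuallyEq_of_isPlot_hectorFiber hP t with ⟨w, h⟩ | ⟨n, p, hp, α, β, hx, hα, hβ, h⟩
  · exact ⟨fun _ => tangentMap f hf hxy w, isPlot_const, h.fun_comp _⟩
  · refine ⟨_, isPlot_hectorFiber_plotDeriv (hf n p hp) hα hβ
      fun t => (congrArg f (hx t)).trans hxy, ?_⟩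
    filter_upwards [h] with s hs
    rw [hs, tangentMap_plotDeriv]

end Fiber

/-! ### Addition of tangent vectors at the identity of a diffeological group -/

section Group

variable {G : Type u} [Group G]

/-- The canonical isomorphism `ℝⁿ × ℝᵐ ≃ ℝⁿ⁺ᵐ`. -/
def eucProd (n m : ℕ) : (Euc n × Euc m) ≃L[ℝ] Euc (n + m) :=
  EuclideanSpace.finAddEquivProd.symm

theorem contDiff_eucProd_symm_fst {n m : ℕ} : ContDiff ℝ ∞ fun z => ((eucProd n m).symm z).1 :=
  contDiff_fst.comp (eucProd n m).symm.contDiff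

theorem contDiff_eucProd_symm_snd {n m : ℕ} : ContDiff ℝ ∞ fun z => ((eucProd n m).symm z).2 :=
  contDiff_snd.comp (eucProd n m).symm.contDiff

/-- The plot `(s, t) ↦ p s * q t`. -/
def extMul {n m : ℕ} (p : Euc n → G) (q : Euc m → G) (z : Euc (n + m)) : G :=
  p ((eucProd n m).symm z).1 * q ((eucProd n m).symm z).2

theorem extMul_apply {n m : ℕ} (p : Euc n → G) (q : Euc m → G) (a : Euc n) (b : Euc m) :
    extMul p q (eucProd n m (a, b)) = p a * q b := by
  simp [extMul]

variable [DiffeologicalSpace G] [DiffeologicalGroup G]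

theorem isPlot_mul {n : ℕ} {p q : Euc n → G} (hp : IsPlot p) (hq : IsPlot q) :
    IsPlot fun t => p t * q t :=
  DiffeologicalGroup.smooth_mul n (fun t => (p t, q t))
    (DiffeologicalSpace.isPlot_inf_iff.mpr ⟨hp, hq⟩)

theorem isPlot_inv {n : ℕ} {p : Euc n → G} (hp : IsPlot p) : IsPlot fun t => (p t)⁻¹ :=
  DiffeologicalGroup.smooth_inv n p hp

theorem isPlot_extMul {n m : ℕ} {p : Euc n → G} {q : Euc m → G} (hp : IsPlot p) (hq : IsPlot q) :
    IsPlot (extMul p q) :=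
  isPlot_mul (isPlot_reparam hp contDiff_eucProd_symm_fst)
    (isPlot_reparam hq contDiff_eucProd_symm_snd)

theorem hasFDerivAt_eucProd_left {n m : ℕ} (a : Euc n) (b : Euc m) :
    HasFDerivAt (fun s => eucProd n m (s, b))
      ((eucProd n m).toContinuousLinearMap ∘L ContinuousLinearMap.inl ℝ (Euc n) (Euc m)) a :=
  (eucProd n m).hasFDerivAt.comp a (hasFDerivAt_prodMk_left a b)

theorem hasFDerivAt_eucProd_right {n m : ℕ} (a : Euc n) (b : Euc m) :
    HasFDerivAt (fun s => eucProd n m (a, s))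
      ((eucProd n m).toContinuousLinearMap ∘L ContinuousLinearMap.inr ℝ (Euc n) (Euc m)) b :=
  (eucProd n m).hasFDerivAt.comp b (hasFDerivAt_prodMk_right a b)

theorem contDiff_eucProd {n m k : ℕ} {f : Euc k → Euc n} {g : Euc k → Euc m}
    (hf : ContDiff ℝ ∞ f) (hg : ContDiff ℝ ∞ g) : ContDiff ℝ ∞ fun s => eucProd n m (f s, g s) :=
  (eucProd n m).contDiff.comp (hf.prodMk hg)

/-- Since `p a = q b = 1`, the slices through `(a, b)` are `p` and `q` themselves. Linearity on `(v,
w) = (v, 0) + (0, w)` does the rest. -/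
theorem plotDeriv_extMul {n m : ℕ} {p : Euc n → G} {q : Euc m → G} (hp : IsPlot p)
    (hq : IsPlot q) {a : Euc n} {b : Euc m} (ha : p a = 1) (hb : q b = 1)
    (h : extMul p q (eucProd n m (a, b)) = 1) (v : Euc n) (w : Euc m) :
    plotDeriv (extMul p q) (isPlot_extMul hp hq) (eucProd n m (a, b)) h (eucProd n m (v, w)) =
      plotDeriv p hp a ha v + plotDeriv q hq b hb w := by
  have h1 : plotDeriv p hp a ha v = plotDeriv (extMul p q) (isPlot_extMul hp hq)
      (eucProd n m (a, b)) h (eucProd n m (v, 0)) :=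
    plotDeriv_chain (g := fun s => eucProd n m (s, b)) (contDiff_eucProd contDiff_id contDiff_const)
      (hasFDerivAt_eucProd_left a b) rfl
      (Filter.Eventually.of_forall fun s => by
        rw [Function.comp_apply, extMul_apply, hb, mul_one]) v
  have h2 : plotDeriv q hq b hb w = plotDeriv (extMul p q) (isPlot_extMul hp hq)
      (eucProd n m (a, b)) h (eucProd n m (0, w)) :=
    plotDeriv_chain (g := fun s => eucProd n m (a, s)) (contDiff_eucProd contDiff_const contDiff_id)
      (hasFDerivAt_eucProd_right a b) rfl
      (Filter.Eventually.of_forall fun s => by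
        rw [Function.comp_apply, extMul_apply, ha, one_mul]) w
  rw [h1, h2, ← map_add, ← map_add, Prod.mk_add_mk, add_zero, zero_add]

/-- The product rule for plots of a diffeological group. -/
theorem plotDeriv_mul {n : ℕ} {p q : Euc n → G} (hp : IsPlot p) (hq : IsPlot q) {a : Euc n}
    (ha : p a = 1) (hb : q a = 1) (h : p a * q a = 1) (v : Euc n) :
    plotDeriv (fun t => p t * q t) (isPlot_mul hp hq) a h v =
      plotDeriv p hp a ha v + plotDeriv q hq a hb v := by
  rw [← plotDeriv_extMul hp hq ha hb ((extMul_apply p q a a).trans h)]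
  -- The pointwise product is `extMul p q` restricted to the diagonal.
  exact plotDeriv_chain (g := fun s => eucProd n n (s, s))
    (g' := (eucProd n n).toContinuousLinearMap ∘L
      ((ContinuousLinearMap.id ℝ (Euc n)).prod (ContinuousLinearMap.id ℝ (Euc n))))
    (contDiff_eucProd contDiff_id contDiff_id)
    ((eucProd n n).hasFDerivAt.comp a ((hasFDerivAt_id a).prodMk (hasFDerivAt_id a))) rfl
    (Filter.Eventually.of_forall fun s => (extMul_apply p q s s).symm) v

/-- By `plotDeriv_extMul`, the vectors represented by single plots are closed under addition. -/
theorem exists_eq_plotDeriv_one (w : InternalTangentSpace G 1) :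
    ∃ (n : ℕ) (p : Euc n → G) (hp : IsPlot p) (a : Euc n) (ha : p a = 1) (v : Euc n),
      w = plotDeriv p hp a ha v := by
  refine InternalTangentSpace.induction (C := fun w => ∃ (n : ℕ) (p : Euc n → G) (hp : IsPlot p)
    (a : Euc n) (ha : p a = 1) (v : Euc n), w = plotDeriv p hp a ha v) (fun r v => ?_) ?_ ?_ w
  · obtain ⟨q, hq, hqx, -, h⟩ := r.exists_push_eq_plotDeriv
    exact ⟨_, q, hq, 0, hqx, v, by rw [h]⟩
  · exact ⟨0, fun _ => 1, isPlot_const, 0, rfl, 0, (map_zero _).symm⟩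
  · rintro _ _ ⟨n, p, hp, a, ha, v, rfl⟩ ⟨m, q, hq, b, hb, w, rfl⟩
    exact ⟨n + m, _, isPlot_extMul hp hq, _, by rw [extMul_apply, ha, hb, mul_one], _,
      (plotDeriv_extMul hp hq ha hb _ v w).symm⟩

theorem isPlot_hectorFiber_one_add {m : ℕ} {P Q : Euc m → InternalTangentSpace G 1}
    (hP : @IsPlot _ (hectorFiberDiffeology (1 : G)) m P)
    (hQ : @IsPlot _ (hectorFiberDiffeology (1 : G)) m Q) :
    @IsPlot _ (hectorFiberDiffeology (1 : G)) m fun t => P t + Q t := by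
  let _ := hectorFiberDiffeology (1 : G)
  refine isPlot_of_eventuallyEq fun t => ?_
  obtain ⟨n, p, hp, α, β, hx, hα, hβ, h⟩ :=
    exists_plotDeriv_of_isPlot_hectorFiber exists_eq_plotDeriv_one hP t
  obtain ⟨k, q, hq, γ, δ, hy, hγ, hδ, h'⟩ :=
    exists_plotDeriv_of_isPlot_hectorFiber exists_eq_plotDeriv_one hQ t
  refine ⟨_, isPlot_hectorFiber_plotDeriv (isPlot_extMul hp hq) (contDiff_eucProd hα hγ)
    (contDiff_eucProd hβ hδ) fun s => by rw [extMul_apply, hx, hy, mul_one], ?_⟩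
  filter_upwards [h, h'] with s hs hs'
  rw [hs, hs', plotDeriv_extMul hp hq (hx s) (hy s)]

theorem hectorFiberDiffeology_one_eq :
    hectorFiberDiffeology (1 : G) = dvsFiberDiffeology (1 : G) :=
  hectorFiberDiffeology_eq_dvsFiberDiffeology 1 (fun _ _ _ => isPlot_hectorFiber_one_add)
    fun _ _ _ hc hP => isPlot_hectorFiber_smul hc hP exists_eq_plotDeriv_one

end Group

/-! ### Lifting from `G ⧸ H` to `G`: exactness, subductions, equality of diffeologies -/

section Coset

variable {G : Type u} [Group G] [DiffeologicalSpace G] (H : Subgroup G)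

theorem exists_lift_of_isPlot_coset {n : ℕ} {p : Euc n → G ⧸ H} (hp : IsPlot p) (t : Euc n) :
    ∃ q : Euc n → G, IsPlot q ∧ (QuotientGroup.mk : G → G ⧸ H) ∘ q =ᶠ[𝓝 t] p :=
  locallyLifts_iff.mp (show LocallyLifts (QuotientGroup.mk : G → G ⧸ H) p from hp) t

theorem cosetTangentMap_plotDeriv {n : ℕ} (p : Euc n → G) (hp : IsPlot p) (a : Euc n)
    (ha : p a = 1) (v : Euc n) :
    cosetTangentMap H (plotDeriv p hp a ha v) =
      plotDeriv ((QuotientGroup.mk : G → G ⧸ H) ∘ p) (dSmooth_coset H n p hp) a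
        (congrArg QuotientGroup.mk ha) v :=
  tangentMap_plotDeriv _ _ _ p hp a ha v

/-- A plot of `H` becomes constant in `G ⧸ H`. -/
theorem cosetTangentMap_subgroupTangentMap (w : InternalTangentSpace H 1) :
    cosetTangentMap H (subgroupTangentMap H w) = 0 := by
  refine InternalTangentSpace.induction
    (C := fun w => cosetTangentMap H (subgroupTangentMap H w) = 0) (fun r v => ?_) ?_ ?_ w
  · obtain ⟨q, hq, hq0, -, h⟩ := r.exists_push_eq_plotDeriv
    have h1 : subgroupTangentMap H (r.push v) =
        plotDeriv ((Subtype.val : H → G) ∘ q) (dSmooth_val _ _ q hq) 0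
          (congrArg Subtype.val hq0) v := by
      rw [h]
      exact tangentMap_plotDeriv _ _ _ q hq 0 hq0 v
    rw [h1, cosetTangentMap_plotDeriv, plotDeriv_eq_zero (Filter.Eventually.of_forall fun t => ?_),
      LinearMap.zero_apply]
    exact QuotientGroup.eq.mpr (by simp)
  · rw [map_zero, map_zero]
  · intro v w hv hw
    rw [map_add, map_add, hv, hw, add_zero]

variable [DiffeologicalGroup G]

theorem CenteredPlot.exists_lift_coset
    (r : CenteredPlot (G ⧸ H) (QuotientGroup.mk (1 : G))) :
    ∃ q : Euc r.dim → G, IsPlot q ∧ q 0 = 1 ∧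
      (QuotientGroup.mk : G → G ⧸ H) ∘ q =ᶠ[𝓝 0] r.toFun := by
  obtain ⟨p, hp, hpx, hrp, -⟩ := r.exists_push_eq_plotDeriv
  obtain ⟨q, hq, h⟩ := exists_lift_of_isPlot_coset H hp 0
  have h0 : q 0 ∈ H := by
    have := h.eq_of_nhds.trans hpx
    simpa using QuotientGroup.eq.mp this
  -- Right multiplication by an element of `H` recentres the lift at `1` without changing left
  -- cosets.
  refine ⟨fun t => q t * (q 0)⁻¹, isPlot_mul hq isPlot_const, mul_inv_cancel _, ?_⟩
  filter_upwards [h, hrp] with t ht ht'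
  rw [ht', ← ht]
  exact QuotientGroup.mk_mul_of_mem _ (H.inv_mem h0)

theorem cosetTangentMap_surjective : Function.Surjective (cosetTangentMap H) := by
  intro w
  refine InternalTangentSpace.induction (C := fun w => ∃ z, cosetTangentMap H z = w)
    (fun r v => ?_) ⟨0, map_zero _⟩ ?_ w
  · obtain ⟨q, hq, hq0, h⟩ := r.exists_lift_coset H
    refine ⟨plotDeriv q hq 0 hq0 v, ?_⟩
    rw [r.push_eq_plotDeriv (dSmooth_coset H _ q hq) (congrArg QuotientGroup.mk hq0) h.symm]
    exact cosetTangentMap_plotDeriv H q hq 0 hq0 v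
  · rintro _ _ ⟨z, rfl⟩ ⟨z', rfl⟩
    exact ⟨z + z', map_add _ _ _⟩

/-- Two lifts of the same germ of a plot of `G ⧸ H` have the same derivative up to vectors tangent
to `H`. -/
theorem plotDeriv_sub_mem_range {n : ℕ} {p q : Euc n → G} (hp : IsPlot p) (hq : IsPlot q)
    {a : Euc n} (ha : p a = 1) (hb : q a = 1)
    (h : (QuotientGroup.mk : G → G ⧸ H) ∘ p =ᶠ[𝓝 a] QuotientGroup.mk ∘ q) (v : Euc n) :
    plotDeriv p hp a ha v - plotDeriv q hq a hb v ∈ LinearMap.range (subgroupTangentMap H) := by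
  have hH : ∀ᶠ t in 𝓝 a, (q t)⁻¹ * p t ∈ H := by
    filter_upwards [h] with t ht
    exact QuotientGroup.eq.mp ht.symm
  obtain ⟨φ, hφ, hφH, hid⟩ := exists_smooth_retraction_of_mem_nhds hH
  -- Near `a` one has `p = q * k`. The retraction `φ` makes `k` take values in `H` everywhere, so it
  -- is a plot of `H`, and the product rule applies.
  let k : Euc n → H := fun t => ⟨(q (φ t))⁻¹ * p (φ t), hφH t⟩
  have hφa : φ a = a := hid.eq_of_nhds
  have hk : IsPlot k :=
    isPlot_mul (isPlot_inv (isPlot_reparam hq hφ)) (isPlot_reparam hp hφ)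
  have hka : k a = 1 := Subtype.ext (by simp [k, hφa, ha, hb])
  have hk' : IsPlot ((Subtype.val : H → G) ∘ k) := hk
  have hka' : ((Subtype.val : H → G) ∘ k) a = 1 := congrArg Subtype.val hka
  have hpk : p =ᶠ[𝓝 a] fun t => q t * ((Subtype.val : H → G) ∘ k) t := by
    filter_upwards [hid] with t ht
    simp [k, ht]
  have h1 : q a * ((Subtype.val : H → G) ∘ k) a = 1 := by rw [hb, hka', mul_one]
  refine ⟨plotDeriv k hk a hka v, ?_⟩
  rw [plotDeriv_congr (hq := isPlot_mul hq hk') (hb := h1) hpk,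
    plotDeriv_mul hq hk' hb hka' h1, add_sub_cancel_left]
  exact tangentMap_plotDeriv _ _ _ k hk a hka v

/-- A lift to `G` of a pointed plot of `G ⧸ H`. -/
def cosetLift (r : CenteredPlot (G ⧸ H) (QuotientGroup.mk (1 : G))) : Euc r.dim → G :=
  (r.exists_lift_coset H).choose

theorem isPlot_cosetLift (r : CenteredPlot (G ⧸ H) (QuotientGroup.mk (1 : G))) :
    IsPlot (cosetLift H r) :=
  (r.exists_lift_coset H).choose_spec.1

theorem cosetLift_zero (r : CenteredPlot (G ⧸ H) (QuotientGroup.mk (1 : G))) :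
    cosetLift H r 0 = 1 :=
  (r.exists_lift_coset H).choose_spec.2.1

theorem mk_cosetLift (r : CenteredPlot (G ⧸ H) (QuotientGroup.mk (1 : G))) :
    (QuotientGroup.mk : G → G ⧸ H) ∘ cosetLift H r =ᶠ[𝓝 0] r.toFun :=
  (r.exists_lift_coset H).choose_spec.2.2

open Classical in
/-- The linear map `⨁ T₀(U) → T_e(G) / T_e(H)` given by the derivatives of lifts to `G`. -/
def cosetTangentSumLift :
    TangentSum (G ⧸ H) (QuotientGroup.mk (1 : G)) →ₗ[ℝ]
      InternalTangentSpace G 1 ⧸ LinearMap.range (subgroupTangentMap H) :=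
  DirectSum.toModule ℝ _ _ fun r => (LinearMap.range (subgroupTangentMap H)).mkQ ∘ₗ
    plotDeriv (cosetLift H r) (isPlot_cosetLift H r) 0 (cosetLift_zero H r)

open Classical in
theorem cosetTangentSumLift_of (r : CenteredPlot (G ⧸ H) (QuotientGroup.mk (1 : G)))
    (v : Euc r.dim) :
    cosetTangentSumLift H (TangentSum.of r v) = (LinearMap.range (subgroupTangentMap H)).mkQ
      (plotDeriv (cosetLift H r) (isPlot_cosetLift H r) 0 (cosetLift_zero H r) v) :=
  DirectSum.toModule_lof ℝ
    (M := fun r : CenteredPlot (G ⧸ H) (QuotientGroup.mk (1 : G)) => Euc r.dim) r v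

/-- For a morphism `f : r ⟶ q`, the chosen lift of `r` and the chosen lift of `q` composed with `f`
lift the same germ. Their derivatives thus agree modulo the range of `ι_*`, whatever lifts were
chosen. -/
theorem tangentRelations_le_ker_cosetTangentSumLift :
    tangentRelations (G ⧸ H) (QuotientGroup.mk (1 : G)) ≤
      LinearMap.ker (cosetTangentSumLift H) := by
  refine Submodule.span_le.mpr ?_
  rintro _ ⟨r, q, f, v, hf, rfl⟩
  have hr := r.isOpen_dom.mem_nhds r.zero_mem
  -- `f` is smooth only on the domain of `r`; `f ∘ φ` is smooth everywhere and has the same germ at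
  -- `0`.
  obtain ⟨φ, hφ, hφr, hid⟩ := exists_smooth_retraction_of_mem_nhds hr
  have hfφ : f ∘ φ =ᶠ[𝓝 0] f := hid.fun_comp f
  have hs : ContDiff ℝ ∞ (f ∘ φ) := hf.contDiffOn.comp_contDiff hφ hφr
  have hs0 : (f ∘ φ) 0 = 0 := hfφ.eq_of_nhds.trans hf.map_zero
  have hderiv : HasFDerivAt (f ∘ φ) (fderiv ℝ f 0) 0 := by
    rw [← hfφ.fderiv_eq]
    exact (hs.differentiable (by simp)).differentiableAt.hasFDerivAt
  have hplot : IsPlot (cosetLift H q ∘ (f ∘ φ)) := isPlot_reparam (isPlot_cosetLift H q) hs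
  have hplot0 : (cosetLift H q ∘ (f ∘ φ)) 0 = 1 :=
    (congrArg (cosetLift H q) hs0).trans (cosetLift_zero H q)
  have hchain : plotDeriv (cosetLift H q ∘ (f ∘ φ)) hplot 0 hplot0 v =
      plotDeriv (cosetLift H q) (isPlot_cosetLift H q) 0 (cosetLift_zero H q) (fderiv ℝ f 0 v) :=
    plotDeriv_chain hs hderiv hs0 Filter.EventuallyEq.rfl v
  have htend : Filter.Tendsto (f ∘ φ) (𝓝 0) (𝓝 0) := by
    have := hs.continuous.tendsto 0
    rwa [hs0] at this
  have hgerm : (QuotientGroup.mk : G → G ⧸ H) ∘ cosetLift H r =ᶠ[𝓝 0]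
      QuotientGroup.mk ∘ (cosetLift H q ∘ (f ∘ φ)) := by
    filter_upwards [mk_cosetLift H r, htend.eventually (mk_cosetLift H q), hr, hfφ]
      with t h1 h2 h3 h4
    rw [h1, hf.comp_eq h3, Function.comp_apply, ← h4]
    exact h2.symm
  change cosetTangentSumLift H _ = 0
  rw [map_sub, cosetTangentSumLift_of, cosetTangentSumLift_of, ← hchain, ← map_sub]
  exact (Submodule.Quotient.mk_eq_zero _).mpr
    (plotDeriv_sub_mem_range H (isPlot_cosetLift H r) hplot (cosetLift_zero H r) hplot0 hgerm v)

/-- The inverse `T_{eH}(G/H) → T_e(G) / T_e(H)` of the map induced by `π_*`. -/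
def cosetTangentLift :
    InternalTangentSpace (G ⧸ H) (QuotientGroup.mk (1 : G)) →ₗ[ℝ]
      InternalTangentSpace G 1 ⧸ LinearMap.range (subgroupTangentMap H) :=
  (tangentRelations (G ⧸ H) (QuotientGroup.mk (1 : G))).liftQ (cosetTangentSumLift H)
    (tangentRelations_le_ker_cosetTangentSumLift H)

/-- A plot of `G` centred at `1` and the chosen lift of its projection are two lifts of one germ. -/
theorem cosetTangentLift_cosetTangentMap (w : InternalTangentSpace G 1) :
    cosetTangentLift H (cosetTangentMap H w) =
      (LinearMap.range (subgroupTangentMap H)).mkQ w := by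
  refine InternalTangentSpace.induction (C := fun w => cosetTangentLift H (cosetTangentMap H w) =
      (LinearMap.range (subgroupTangentMap H)).mkQ w) (fun r v => ?_) ?_ ?_ w
  · let s : CenteredPlot (G ⧸ H) (QuotientGroup.mk (1 : G)) :=
      r.comp QuotientGroup.mk (dSmooth_coset H) rfl
    have h1 : cosetTangentMap H (r.push v) = s.push v := tangentMap_push _ _ _ r v
    have h2 : cosetTangentLift H (s.push v) = _ :=
      cosetTangentSumLift_of H s v
    obtain ⟨q, hq, hq0, hrq, h⟩ := r.exists_push_eq_plotDeriv
    rw [h1, h2, h]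
    refine (Submodule.Quotient.eq _).mpr (plotDeriv_sub_mem_range H (isPlot_cosetLift H s) hq
      (cosetLift_zero H s) hq0 ((mk_cosetLift H s).trans ?_) v)
    exact hrq.fun_comp QuotientGroup.mk
  · rw [map_zero, map_zero, map_zero]
  · intro v w hv hw
    rw [map_add, map_add, map_add, hv, hw]

theorem exact_subgroupTangentMap_cosetTangentMap :
    Function.Exact (subgroupTangentMap H) (cosetTangentMap H) := by
  refine fun w => ⟨fun hw => ?_, ?_⟩
  · have h := cosetTangentLift_cosetTangentMap H w
    rw [hw, map_zero] at h
    exact (Submodule.Quotient.mk_eq_zero _).mp h.symm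
  · rintro ⟨z, rfl⟩
    exact cosetTangentMap_subgroupTangentMap H z

/-- Plots of `T^H_{eH}(G/H)` lift locally along `π_*` to plots of `T^H_e(G)`. -/
theorem exists_lift_of_isPlot_hectorFiber_coset {m : ℕ}
    {P : Euc m → InternalTangentSpace (G ⧸ H) (QuotientGroup.mk (1 : G))}
    (hP : @IsPlot _ (hectorFiberDiffeology (QuotientGroup.mk (1 : G) : G ⧸ H)) m P)
    (t₀ : Euc m) :
    ∃ Q : Euc m → InternalTangentSpace G 1, @IsPlot _ (hectorFiberDiffeology (1 : G)) m Q ∧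
      cosetTangentMap H ∘ Q =ᶠ[𝓝 t₀] P := by
  rcases eventuallyEq_of_isPlot_hectorFiber hP t₀ with ⟨w, h⟩ | ⟨n, p, hp, α, β, hx, hα, hβ, h⟩
  · obtain ⟨z, rfl⟩ := cosetTangentMap_surjective H w
    exact ⟨fun _ => z, @isPlot_const _ (hectorFiberDiffeology (1 : G)) m z, h.symm⟩
  · obtain ⟨q, hq, hqp⟩ := exists_lift_of_isPlot_coset H hp (α t₀)
    obtain ⟨φ, hφ, hφq, hid⟩ := exists_smooth_retraction_of_mem_nhds
      ((hα.continuous.continuousAt (x := t₀)).eventually hqp.eventuallyEq_nhds)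
    have hqα : ∀ t, (QuotientGroup.mk : G → G ⧸ H) ∘ q =ᶠ[𝓝 (α (φ t))] p := hφq
    have hαφ : ContDiff ℝ ∞ (α ∘ φ) := hα.comp hφ
    have hH : ∀ t, q (α (φ t)) ∈ H := fun t => by
      have := (hqα t).eq_of_nhds.trans (hx (φ t))
      simpa using QuotientGroup.eq.mp this
    -- The correction needs its own parameter `t`: `q s * k t` is then `1` along `s = α (φ t)`, and
    -- the direction `(β (φ t), 0)` leaves `k` undifferentiated.
    let k : Euc m → G := fun t => (q (α (φ t)))⁻¹
    have hk : IsPlot k := isPlot_inv (isPlot_reparam hq hαφ)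
    have h1 : ∀ t, extMul q k (eucProd n m ((α ∘ φ) t, t)) = 1 := fun t => by
      rw [extMul_apply]
      exact mul_inv_cancel _
    refine ⟨_, isPlot_hectorFiber_plotDeriv (isPlot_extMul hq hk)
      (contDiff_eucProd hαφ contDiff_id)
      (contDiff_eucProd (hβ.comp hφ) (contDiff_const (c := 0))) h1, ?_⟩
    -- For fixed `t`, the slice `s ↦ q s * k t` projects to `p` near `α (φ t)`, because `k t ∈ H`.
    have key : ∀ t, plotDeriv p hp (α (φ t)) (hx (φ t)) (β (φ t)) =
        cosetTangentMap H (plotDeriv (extMul q k) (isPlot_extMul hq hk)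
          (eucProd n m ((α ∘ φ) t, t)) (h1 t) (eucProd n m ((β ∘ φ) t, 0))) := fun t => by
      rw [cosetTangentMap_plotDeriv]
      refine plotDeriv_chain (g := fun s => eucProd n m (s, t))
        (contDiff_eucProd contDiff_id contDiff_const) (hasFDerivAt_eucProd_left _ t) rfl ?_ _
      filter_upwards [hqα t] with s hs
      rw [← hs]
      simp only [Function.comp_apply, extMul_apply]
      exact (QuotientGroup.mk_mul_of_mem _ (H.inv_mem (hH t))).symm
    have hPφ : P ∘ φ =ᶠ[𝓝 t₀] P := hid.fun_comp P
    have ht : Filter.Tendsto φ (𝓝 t₀) (𝓝 t₀) := by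
      have := hφ.continuous.tendsto t₀
      rwa [hid.eq_of_nhds] at this
    filter_upwards [hPφ, ht.eventually h] with t e1 e2
    exact ((e1.symm.trans e2).trans (key t)).symm

theorem isSubduction_hectorFiber_cosetTangentMap :
    IsSubduction (hectorFiberDiffeology (1 : G))
      (hectorFiberDiffeology (QuotientGroup.mk (1 : G) : G ⧸ H)) (cosetTangentMap H) := by
  refine ⟨cosetTangentMap_surjective H, fun n P => ?_⟩
  let _ := hectorFiberDiffeology (1 : G)
  let _ := hectorFiberDiffeology (QuotientGroup.mk (1 : G) : G ⧸ H)
  rw [locallyLifts_iff]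
  refine ⟨fun hP => exists_lift_of_isPlot_hectorFiber_coset H hP, fun h => ?_⟩
  refine isPlot_of_eventuallyEq fun t => ?_
  obtain ⟨Q, hQ, hQP⟩ := h t
  exact ⟨_, isPlot_hectorFiber_tangentMap _ (dSmooth_coset H) rfl hQ, hQP.symm⟩

/-- Sums of plots are formed after lifting locally to the tangent space of `G` at `1`, then pushed
forward by `π_*`. Surjectivity of `π_*` supplies the single-plot representatives needed for scalar
multiplication. -/
theorem hectorFiberDiffeology_coset_eq :
    hectorFiberDiffeology (QuotientGroup.mk (1 : G) : G ⧸ H) =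
      dvsFiberDiffeology (QuotientGroup.mk (1 : G) : G ⧸ H) := by
  refine hectorFiberDiffeology_eq_dvsFiberDiffeology _ (fun m P Q hP hQ => ?_)
    fun m c P hc hP => isPlot_hectorFiber_smul hc hP fun w => ?_
  · let _ := hectorFiberDiffeology (QuotientGroup.mk (1 : G) : G ⧸ H)
    refine isPlot_of_eventuallyEq fun t => ?_
    obtain ⟨P', hP', h⟩ := exists_lift_of_isPlot_hectorFiber_coset H hP t
    obtain ⟨Q', hQ', h'⟩ := exists_lift_of_isPlot_hectorFiber_coset H hQ t
    refine ⟨_, isPlot_hectorFiber_tangentMap _ (dSmooth_coset H) rfl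
      (isPlot_hectorFiber_one_add hP' hQ'), ?_⟩
    filter_upwards [h, h'] with s hs hs'
    rw [← hs, ← hs', map_add]
    rfl
  · obtain ⟨z, rfl⟩ := cosetTangentMap_surjective H w
    obtain ⟨n, p, hp, a, ha, v, rfl⟩ := exists_eq_plotDeriv_one z
    exact ⟨n, _, _, a, _, v, cosetTangentMap_plotDeriv H p hp a ha v⟩

end Coset

end Diffeology

end

open Diffeology
theorem corollary3p3 {G : Type*} [Group G] [DiffeologicalSpace G] [DiffeologicalGroup G]
    (H : Subgroup G) :
    (Function.Exact (subgroupTangentMap H) (cosetTangentMap H) ∧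
      Function.Surjective (cosetTangentMap H)) ∧
    hectorFiberDiffeology (QuotientGroup.mk (1 : G) : G ⧸ H) =
      dvsFiberDiffeology (QuotientGroup.mk (1 : G) : G ⧸ H) ∧
    IsSubduction (hectorFiberDiffeology (1 : G))
      (hectorFiberDiffeology (QuotientGroup.mk (1 : G) : G ⧸ H)) (cosetTangentMap H) ∧
    IsSubduction (dvsFiberDiffeology (1 : G))
      (dvsFiberDiffeology (QuotientGroup.mk (1 : G) : G ⧸ H)) (cosetTangentMap H) := by
  refine ⟨⟨exact_subgroupTangentMap_cosetTangentMap H, cosetTangentMap_surjective H⟩,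
    hectorFiberDiffeology_coset_eq H, isSubduction_hectorFiber_cosetTangentMap H, ?_⟩
  rw [← hectorFiberDiffeology_one_eq, ← hectorFiberDiffeology_coset_eq H]
  exact isSubduction_hectorFiber_cosetTangentMap H
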